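/- Let $J^k(n,p)$ denote the vector space of $k$-jets at $0$ of $C^\infty$ map germs $f:(\mathbb{R}^n,0)\to(\mathbb{R}^p,0)$. Let $\mathcal{K}$ be the contact group, whose elements are pairs $(h,\phi)$ with $h$ a germ of a local diffeomorphism of $(\mathbb{R}^n,0)$ and $\phi:(\mathbb{R}^n,0)\to GL(\mathbb{R}^p)$ a smooth germ; it acts on germs by $f\mapsto\big(x\mapsto\phi(x)\,f(h(x))\big)$, and hence on $J^k(n,p)$. For $k\ge 1$ let $\Sigma^i(n,p)\subset J^k(n,p)$ be the set of jets $j^k_0f$ with $\dim\operatorname{Ker}(d_0f)=i$. For $\rho\ge1$ let $W^k_\rho(n,p)$ be the set of all $z\in J^k(n,p)$ such that the codimension of the orbit $\mathcal{K}z$ in $J^k(n,p)$ is at least $\rho$. **Proposition 4.3.** Let $n,p,\ell$ be nonnegative integers, let $0\le i\le n$, and let $k\ge p+\ell+1$. If $\Sigma^i(n,p)\subset W^k_{\ell+1}(n,p)$, then for every positive integer $m$ $$\Sigma^i(m+n,\,m+p)\subset W^k_{\ell+1}(m+n,\,m+p).$$ -/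

import Mathlib

open scoped ContDiff Topology

noncomputable section

namespace KJet

/-- `f` is smooth (of class `C^∞`) on some neighbourhood of `a`. (This asks for a single
neighbourhood; `ContDiffAt ℝ ∞ f a` alone would let it shrink with the order.) -/
def SmoothNear {E F : Type*} [NormedAddCommGroup E] [NormedSpace ℝ E]
    [NormedAddCommGroup F] [NormedSpace ℝ F] (f : E → F) (a : E) : Prop :=
  ∀ᶠ x in 𝓝 a, ContDiffAt ℝ ∞ f x

/-- (Representatives of) smooth map germs `(ℝⁿ, 0) → (ℝᵖ, 0)`, as a real vector space. -/
def MapGerm (n p : ℕ) :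
    Submodule ℝ (EuclideanSpace ℝ (Fin n) → EuclideanSpace ℝ (Fin p)) where
  carrier := {f | SmoothNear f 0 ∧ f 0 = 0}
  add_mem' := by
    rintro f g ⟨hf, hf0⟩ ⟨hg, hg0⟩
    refine ⟨?_, by simp [hf0, hg0]⟩
    filter_upwards [hf, hg] with x h1 h2 using h1.add h2
  zero_mem' := ⟨Filter.Eventually.of_forall fun _ => contDiffAt_const, rfl⟩
  smul_mem' := by
    rintro c f ⟨hf, hf0⟩
    refine ⟨?_, by simp [hf0]⟩
    filter_upwards [hf] with x h1 using h1.const_smul c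

theorem MapGerm.contDiffAt {n p : ℕ} (f : MapGerm n p) : ContDiffAt ℝ ∞ f.1 0 :=
  f.2.1.self_of_nhds

/-- The map germs all of whose derivatives of order at most `k` vanish at the origin. -/
def flatGerms (k n p : ℕ) : Submodule ℝ (MapGerm n p) where
  carrier := {f | ∀ j ≤ k, iteratedFDeriv ℝ j f.1 0 = 0}
  add_mem' := by
    intro f g hf hg j hj
    have h := iteratedFDeriv_add_apply (𝕜 := ℝ) (i := j)
      ((MapGerm.contDiffAt f).of_le (by exact_mod_cast le_top))
      ((MapGerm.contDiffAt g).of_le (by exact_mod_cast le_top))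
    change iteratedFDeriv ℝ j (f.1 + g.1) 0 = 0
    rw [h, hf j hj, hg j hj, add_zero]
  zero_mem' := by
    intro j _
    change iteratedFDeriv ℝ j (fun _ => 0) 0 = 0
    simp
  smul_mem' := by
    intro c f hf j hj
    have h := iteratedFDeriv_const_smul_apply (𝕜 := ℝ) (i := j) (a := c)
      ((MapGerm.contDiffAt f).of_le (by exact_mod_cast le_top))
    change iteratedFDeriv ℝ j (c • f.1) 0 = 0
    rw [h, hf j hj, smul_zero]

/-- The jet space `J^k(n,p)`: smooth map germs `(ℝⁿ, 0) → (ℝᵖ, 0)`, two germs being identified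
when all their derivatives of order at most `k` at the origin agree. -/
abbrev Jet (k n p : ℕ) : Type := MapGerm n p ⧸ flatGerms k n p

/-- The `k`-jet `j₀ᵏ f` at the origin. -/
def jet (k : ℕ) {n p : ℕ} (f : MapGerm n p) : Jet k n p := (flatGerms k n p).mkQ f

/-- `Σ^i(n,p) ⊆ J^k(n,p)`, `k ≥ 1`: the jets of kernel rank `i`, i.e. the jets of germs whose
differential at the origin has an `i`-dimensional kernel. -/
def SigmaSet (i k n p : ℕ) : Set (Jet k n p) :=
  {z | ∃ f : MapGerm n p, jet k f = z ∧
    Module.finrank ℝ (LinearMap.ker (fderiv ℝ f.1 0).toLinearMap) = i}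

/-- The pair `(h, φ)` represents an element of the contact group `𝒦`: `h` is a local
diffeomorphism of `(ℝⁿ, 0)` and `φ` is a smooth germ at `0 ∈ ℝⁿ` of a map into `GL(ℝᵖ)`.
It acts on map germs by `f ↦ φ(x) · f(h(x))`. -/
structure IsContactElement {n p : ℕ}
    (h : EuclideanSpace ℝ (Fin n) → EuclideanSpace ℝ (Fin n))
    (φ : EuclideanSpace ℝ (Fin n) → (EuclideanSpace ℝ (Fin p) →L[ℝ] EuclideanSpace ℝ (Fin p))) :
    Prop where
  smooth_source : SmoothNear h 0
  map_zero : h 0 = 0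
  isUnit_fderiv : IsUnit (fderiv ℝ h 0)
  smooth_matrix : SmoothNear φ 0
  isUnit_matrix : ∀ᶠ x in 𝓝 0, IsUnit (φ x)

/-- A smooth curve `t ↦ (H t, Φ t)`, `t` near `0`, in the contact group `𝒦` that passes through
the identity at `t = 0`. -/
structure ContactCurve (n p : ℕ) where
  H : ℝ → EuclideanSpace ℝ (Fin n) → EuclideanSpace ℝ (Fin n)
  Φ : ℝ → EuclideanSpace ℝ (Fin n) → (EuclideanSpace ℝ (Fin p) →L[ℝ] EuclideanSpace ℝ (Fin p))
  mem_contact : ∀ᶠ t in 𝓝 (0 : ℝ), IsContactElement (H t) (Φ t)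
  smooth_H : SmoothNear (fun q : ℝ × EuclideanSpace ℝ (Fin n) => H q.1 q.2) (0, 0)
  smooth_Φ : SmoothNear (fun q : ℝ × EuclideanSpace ℝ (Fin n) => Φ q.1 q.2) (0, 0)
  H_zero : ∀ᶠ x in 𝓝 0, H 0 x = x
  Φ_zero : ∀ᶠ x in 𝓝 0, Φ 0 x = 1

/-- The tangent space `T_z(𝒦z)` of the `𝒦`-orbit through `z` in the vector space `J^k(n,p)`,
i.e. the image of the differential at the identity of the orbit map `γ ↦ γ · z`: it consists of
the velocities at `t = 0` of the curves `t ↦ γ_t · z`, for `γ` a smooth curve in `𝒦` through the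
identity. With `z = j₀ᵏ f` and `γ_t = (H t, Φ t)` such a velocity is the `k`-jet of the germ
`w(x) = ∂/∂t|₀ (Φ t x · f (H t x))`. -/
def orbitTangent (k : ℕ) {n p : ℕ} (z : Jet k n p) : Submodule ℝ (Jet k n p) :=
  Submodule.span ℝ {v | ∃ (f w : MapGerm n p) (γ : ContactCurve n p), jet k f = z ∧ jet k w = v ∧
    ∀ᶠ x in 𝓝 0, HasDerivAt (fun t : ℝ => γ.Φ t x (f.1 (γ.H t x))) (w.1 x) 0}

/-- The codimension in `J^k(n,p)` of the orbit `𝒦z`. -/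
def orbitCodim (k : ℕ) {n p : ℕ} (z : Jet k n p) : Cardinal :=
  Module.rank ℝ (Jet k n p ⧸ orbitTangent k z)

/-- `W_ρ^k(n,p)`: the jets whose `𝒦`-orbit has codimension at least `ρ` in `J^k(n,p)`. -/
def WSet (ρ k n p : ℕ) : Set (Jet k n p) :=
  {z | (ρ : Cardinal) ≤ orbitCodim k z}

end KJet

end

/-! A germ `f` in `Σ^i(m+n, m+p)` has rank `m + n - i ≥ m` at `0`, so `m` components of `f`, in
suitable linear coordinates of the target, form a submersion `π ∘ f`. Restricting the other
components to the `n`-dimensional zero set of `π ∘ f` gives a germ `g` from `ℝⁿ` to `ℝᵖ` whose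
differential has a kernel of the same dimension `i` (`exists_restriction`). By hypothesis the orbit
of `g` has codimension at least `l + 1`, so it suffices that passing from `f` to `g` does not raise
the codimension.

The tangent space to the orbit of `f` consists of the jets of `A · f + df · ξ` with `ξ(0) = 0`.
Restriction to the zero set, followed by a projection `B` of the target depending on the point, is a
surjection of jet spaces. If `B · df` factors as `dg · κ`, it carries this tangent space into that
of `g`, and so induces a surjection of the quotients (`orbitCodim_le_of_restriction`). -/

noncomputable section

namespace KJet

/-! ### Smooth germs and flatness to order `k`. -/

section Smooth

variable {E F G : Type*} [NormedAddCommGroup E] [NormedSpace ℝ E]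
  [NormedAddCommGroup F] [NormedSpace ℝ F] [NormedAddCommGroup G] [NormedSpace ℝ G]

theorem _root_.ContDiff.smoothNear {f : E → F} (hf : ContDiff ℝ ∞ f) (a : E) : SmoothNear f a :=
  Filter.Eventually.of_forall fun _ => hf.contDiffAt

theorem _root_.ContinuousLinearMap.smoothNear (L : E →L[ℝ] F) (a : E) : SmoothNear L a :=
  L.contDiff.smoothNear a

theorem SmoothNear.contDiffAt {f : E → F} {a : E} (hf : SmoothNear f a) : ContDiffAt ℝ ∞ f a :=
  hf.self_of_nhds

theorem SmoothNear.continuousAt {f : E → F} {a : E} (hf : SmoothNear f a) : ContinuousAt f a :=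
  hf.contDiffAt.continuousAt

theorem SmoothNear.eventually_differentiableAt {f : E → F} {a : E} (hf : SmoothNear f a) :
    ∀ᶠ x in 𝓝 a, DifferentiableAt ℝ f x := by
  filter_upwards [hf] with x hx using hx.differentiableAt (by simp)

theorem SmoothNear.comp {g : F → G} {f : E → F} {a : E} {b : F} (hg : SmoothNear g b)
    (hf : SmoothNear f a) (hb : f a = b) : SmoothNear (fun x => g (f x)) a := by
  subst hb
  filter_upwards [hf, hf.continuousAt.eventually hg] with x h1 h2 using h2.comp x h1

theorem SmoothNear.clm_apply {A : E → F →L[ℝ] G} {f : E → F} {a : E} (hA : SmoothNear A a)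
    (hf : SmoothNear f a) : SmoothNear (fun x => A x (f x)) a := by
  filter_upwards [hA, hf] with x h1 h2 using h1.clm_apply h2

theorem SmoothNear.clm_comp {H : Type*} [NormedAddCommGroup H] [NormedSpace ℝ H]
    {A : E → F →L[ℝ] G} {B : E → H →L[ℝ] F} {a : E} (hA : SmoothNear A a)
    (hB : SmoothNear B a) : SmoothNear (fun x => (A x).comp (B x)) a := by
  filter_upwards [hA, hB] with x h1 h2 using h1.clm_comp h2

theorem SmoothNear.add {f g : E → F} {a : E} (hf : SmoothNear f a)
    (hg : SmoothNear g a) : SmoothNear (fun x => f x + g x) a := by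
  filter_upwards [hf, hg] with x h1 h2 using h1.add h2

theorem SmoothNear.sub {f g : E → F} {a : E} (hf : SmoothNear f a)
    (hg : SmoothNear g a) : SmoothNear (fun x => f x - g x) a := by
  filter_upwards [hf, hg] with x h1 h2 using h1.sub h2

theorem SmoothNear.smul {c : E → ℝ} {f : E → F} {a : E} (hc : SmoothNear c a)
    (hf : SmoothNear f a) : SmoothNear (fun x => c x • f x) a := by
  filter_upwards [hc, hf] with x h1 h2 using h1.smul h2

theorem SmoothNear.fderiv {f : E → F} {a : E} (hf : SmoothNear f a) :
    SmoothNear (fderiv ℝ f) a := by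
  filter_upwards [hf] with x h using h.fderiv_right (by simp)

/-- A smooth germ is represented by a function of class `C^∞` on an open set. -/
theorem SmoothNear.exists_isOpen {f : E → F} {a : E} (hf : SmoothNear f a) :
    ∃ s, IsOpen s ∧ a ∈ s ∧ ContDiffOn ℝ ∞ f s := by
  obtain ⟨s, hs, ho, ha⟩ := eventually_nhds_iff.1 hf
  exact ⟨s, ho, ha, fun x hx => (hs x hx).contDiffWithinAt⟩

/-- All derivatives of `f` of order at most `k` vanish at `a`. -/
def FlatAt (k : ℕ) (f : E → F) (a : E) : Prop := ∀ j ≤ k, iteratedFDeriv ℝ j f a = 0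

theorem FlatAt.congr {k : ℕ} {f g : E → F} {a : E} (hf : FlatAt k f a) (h : g =ᶠ[𝓝 a] f) :
    FlatAt k g a := fun j hj => by
  rw [(h.iteratedFDeriv ℝ j).self_of_nhds, hf j hj]

theorem FlatAt.add {k : ℕ} {f g : E → F} {a : E} (hf : FlatAt k f a) (hg : FlatAt k g a)
    (hf' : SmoothNear f a) (hg' : SmoothNear g a) : FlatAt k (fun x => f x + g x) a :=
  fun j hj => by
    have h := iteratedFDeriv_add_apply (𝕜 := ℝ) (i := j)
      (hf'.contDiffAt.of_le (by exact_mod_cast le_top))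
      (hg'.contDiffAt.of_le (by exact_mod_cast le_top))
    change iteratedFDeriv ℝ j (f + g) a = 0
    rw [h, hf j hj, hg j hj, add_zero]

theorem FlatAt.comp {k : ℕ} {g : F → G} {f : E → F} {a : E} {b : F} (hg : FlatAt k g b)
    (hg' : SmoothNear g b) (hf : SmoothNear f a) (hb : f a = b) :
    FlatAt k (fun x => g (f x)) a := by
  subst hb
  intro j hj
  obtain ⟨t, hto, hat, ht⟩ := hg'.exists_isOpen
  obtain ⟨s', hso', has', hs'⟩ := hf.exists_isOpen
  obtain ⟨s, hss, hso, has⟩ := mem_nhds_iff.1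
    (Filter.inter_mem (hso'.mem_nhds has') (hf.continuousAt.preimage_mem_nhds (hto.mem_nhds hat)))
  have hD : ∃ D : ℝ, ∀ i, 1 ≤ i → i ≤ j → ‖iteratedFDerivWithin ℝ i f s a‖ ≤ D ^ i := by
    refine ⟨1 + ∑ i ∈ Finset.range (j + 1), ‖iteratedFDerivWithin ℝ i f s a‖, fun i h1 h2 => ?_⟩
    have h3 : ‖iteratedFDerivWithin ℝ i f s a‖ ≤
        ∑ i ∈ Finset.range (j + 1), ‖iteratedFDerivWithin ℝ i f s a‖ :=
      Finset.single_le_sum (f := fun i => ‖iteratedFDerivWithin ℝ i f s a‖)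
        (fun _ _ => norm_nonneg _) (Finset.mem_range.2 (by omega))
    have h4 := norm_nonneg (iteratedFDerivWithin ℝ i f s a)
    exact (h3.trans (by linarith)).trans (le_self_pow₀ (by linarith) (by omega))
  obtain ⟨D, hD⟩ := hD
  -- The Faà di Bruno bound is proportional to `C`; flatness of `g` allows `C = 0`.
  have key := norm_iteratedFDerivWithin_comp_le (n := j) (C := 0) (D := D) ht
    (hs'.mono fun x hx => (hss hx).1) (by exact_mod_cast le_top) hto.uniqueDiffOn
    hso.uniqueDiffOn (fun x hx => (hss hx).2) has
    (fun i hi => by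
      rw [iteratedFDerivWithin_of_isOpen i hto hat, hg i (hi.trans hj), norm_zero]) hD
  rw [iteratedFDerivWithin_of_isOpen j hso has] at key
  simpa [Function.comp_def] using key

/-- By the Leibniz bound, it is enough that each product in the expansion has a vanishing factor. -/
theorem iteratedFDeriv_clm_apply_eq_zero {A : E → F →L[ℝ] G} {f : E → F} {a : E} {j : ℕ}
    (hA : SmoothNear A a) (hf : SmoothNear f a)
    (h : ∀ i ≤ j, iteratedFDeriv ℝ i A a = 0 ∨ iteratedFDeriv ℝ (j - i) f a = 0) :
    iteratedFDeriv ℝ j (fun x => A x (f x)) a = 0 := by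
  obtain ⟨t, hto, hat, ht⟩ := hA.exists_isOpen
  obtain ⟨s, hso, has, hs⟩ := hf.exists_isOpen
  have ho := hto.inter hso
  have key := norm_iteratedFDerivWithin_clm_apply (n := j) (ht.mono Set.inter_subset_left)
    (hs.mono Set.inter_subset_right) ho.uniqueDiffOn ⟨hat, has⟩ (by exact_mod_cast le_top)
  simp only [iteratedFDerivWithin_of_isOpen _ ho (⟨hat, has⟩ : a ∈ t ∩ s)] at key
  rw [Finset.sum_eq_zero] at key
  · simpa using key
  · intro i hi
    rcases h i (by simpa [Nat.lt_succ_iff] using hi) with h | h <;> simp [h]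

theorem FlatAt.clm_apply {k : ℕ} {A : E → F →L[ℝ] G} {f : E → F} {a : E}
    (hf : FlatAt k f a) (hA : SmoothNear A a) (hf' : SmoothNear f a) :
    FlatAt k (fun x => A x (f x)) a := fun j hj =>
  iteratedFDeriv_clm_apply_eq_zero hA hf' fun i _ => Or.inr (hf _ (by omega))

/-- The derivative of a `k`-flat germ along a vector field vanishing at the origin is `k`-flat. -/
theorem FlatAt.fderiv_apply {k : ℕ} {f : E → F} {ξ : E → E} {a : E}
    (hf : FlatAt k f a) (hf' : SmoothNear f a) (hξ : SmoothNear ξ a) (h0 : ξ a = 0) :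
    FlatAt k (fun x => fderiv ℝ f x (ξ x)) a := fun j hj =>
  iteratedFDeriv_clm_apply_eq_zero hf'.fderiv hξ fun i hi => by
    -- Differentiating `f` costs one order of flatness; only `i = j = k` is affected, and there the
    -- other factor is `ξ a = 0`.
    rcases Nat.lt_or_ge i k with h | h
    · left
      rw [← norm_eq_zero, norm_iteratedFDeriv_fderiv, hf _ h, norm_zero]
    · right
      obtain rfl : i = j := by omega
      rw [Nat.sub_self, ← norm_eq_zero, norm_iteratedFDeriv_zero, h0, norm_zero]

end Smooth

/-! ### The orbit tangent space as the infinitesimal contact action. -/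

section Tangent

variable {k n p : ℕ}

theorem jet_eq_iff {f g : MapGerm n p} : jet k f = jet k g ↔ FlatAt k (f - g).1 0 :=
  Submodule.Quotient.eq (flatGerms k n p)

theorem jet_eq_of_eventuallyEq {f g : MapGerm n p} (h : f.1 =ᶠ[𝓝 0] g.1) :
    jet k f = jet k g := by
  rw [jet_eq_iff]
  have h0 : FlatAt k (fun _ => 0 : EuclideanSpace ℝ (Fin n) → EuclideanSpace ℝ (Fin p)) 0 :=
    fun j _ => by simp
  refine h0.congr ?_
  filter_upwards [h] with x hx
  simp [hx]

/-- The germ `A · f + df · ξ` of the infinitesimal action of the contact group. -/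
def infinitesimalAction (f : MapGerm n p)
    (A : EuclideanSpace ℝ (Fin n) → (EuclideanSpace ℝ (Fin p) →L[ℝ] EuclideanSpace ℝ (Fin p)))
    (ξ : EuclideanSpace ℝ (Fin n) → EuclideanSpace ℝ (Fin n))
    (hA : SmoothNear A 0) (hξ : SmoothNear ξ 0) (h0 : ξ 0 = 0) : MapGerm n p :=
  ⟨fun x => A x (f.1 x) + fderiv ℝ f.1 x (ξ x),
    (hA.clm_apply f.2.1).add (f.2.1.fderiv.clm_apply hξ), by simp [f.2.2, h0]⟩

theorem exists_infinitesimalAction_eventuallyEq {f w : MapGerm n p} {γ : ContactCurve n p}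
    (hw : ∀ᶠ x in 𝓝 0, HasDerivAt (fun t : ℝ => γ.Φ t x (f.1 (γ.H t x))) (w.1 x) 0) :
    ∃ A ξ, ∃ (hA : SmoothNear A 0) (hξ : SmoothNear ξ 0) (h0 : ξ 0 = 0),
      w.1 =ᶠ[𝓝 0] (infinitesimalAction f A ξ hA hξ h0).1 := by
  have hi : SmoothNear (fun x : EuclideanSpace ℝ (Fin n) => ((0 : ℝ), x)) 0 :=
    (contDiff_const.prodMk contDiff_id).smoothNear 0
  have hc : SmoothNear (fun _ : EuclideanSpace ℝ (Fin n) =>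
      ((1 : ℝ), (0 : EuclideanSpace ℝ (Fin n)))) 0 := contDiff_const.smoothNear 0
  have hline (x : EuclideanSpace ℝ (Fin n)) :
      HasDerivAt (fun t : ℝ => (t, x)) ((1 : ℝ), (0 : EuclideanSpace ℝ (Fin n))) 0 :=
    (hasDerivAt_id 0).prodMk (hasDerivAt_const 0 x)
  have hH (x : EuclideanSpace ℝ (Fin n))
      (hx : DifferentiableAt ℝ
        (fun q : ℝ × EuclideanSpace ℝ (Fin n) => γ.H q.1 q.2) (0, x)) :
      HasDerivAt (fun t => γ.H t x) (fderiv ℝ (fun q : ℝ × EuclideanSpace ℝ (Fin n) =>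
        γ.H q.1 q.2) (0, x) (1, 0)) 0 :=
    HasFDerivAt.comp_hasDerivAt (f := fun t : ℝ => (t, x)) (0 : ℝ) hx.hasFDerivAt (hline x)
  have hΦ (x : EuclideanSpace ℝ (Fin n))
      (hx : DifferentiableAt ℝ
        (fun q : ℝ × EuclideanSpace ℝ (Fin n) => γ.Φ q.1 q.2) (0, x)) :
      HasDerivAt (fun t => γ.Φ t x) (fderiv ℝ (fun q : ℝ × EuclideanSpace ℝ (Fin n) =>
        γ.Φ q.1 q.2) (0, x) (1, 0)) 0 :=
    HasFDerivAt.comp_hasDerivAt (f := fun t : ℝ => (t, x)) (0 : ℝ) hx.hasFDerivAt (hline x)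
  have hdH := hi.continuousAt.eventually γ.smooth_H.eventually_differentiableAt
  have hdΦ := hi.continuousAt.eventually γ.smooth_Φ.eventually_differentiableAt
  refine ⟨fun x => fderiv ℝ (fun q : ℝ × EuclideanSpace ℝ (Fin n) => γ.Φ q.1 q.2) (0, x) (1, 0),
    fun x => fderiv ℝ (fun q : ℝ × EuclideanSpace ℝ (Fin n) => γ.H q.1 q.2) (0, x) (1, 0),
    (γ.smooth_Φ.fderiv.comp hi rfl).clm_apply hc, (γ.smooth_H.fderiv.comp hi rfl).clm_apply hc,
    ?_, ?_⟩
  · have h0 : (fun t => γ.H t 0) =ᶠ[𝓝 0] fun _ => 0 := by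
      filter_upwards [γ.mem_contact] with t ht using ht.map_zero
    exact (hH 0 hdH.self_of_nhds).unique ((hasDerivAt_const _ _).congr_of_eventuallyEq h0)
  · filter_upwards [hw, hdH, hdΦ, γ.H_zero, γ.Φ_zero, f.2.1.eventually_differentiableAt]
      with x h1 h2 h3 h4 h5 h6
    have h7 := (hΦ x h3).clm_apply
      ((show HasFDerivAt f.1 (fderiv ℝ f.1 x) (γ.H 0 x) by
        rw [h4]; exact h6.hasFDerivAt).comp_hasDerivAt (0 : ℝ) (hH x h2))
    have h8 := h1.unique h7
    simpa [infinitesimalAction, h4, h5] using h8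

theorem jet_infinitesimalAction_mem (f : MapGerm n p)
    (A : EuclideanSpace ℝ (Fin n) → (EuclideanSpace ℝ (Fin p) →L[ℝ] EuclideanSpace ℝ (Fin p)))
    (ξ : EuclideanSpace ℝ (Fin n) → EuclideanSpace ℝ (Fin n))
    (hA : SmoothNear A 0) (hξ : SmoothNear ξ 0) (h0 : ξ 0 = 0) :
    jet k (infinitesimalAction f A ξ hA hξ h0) ∈ orbitTangent k (jet k f) := by
  have hfst : SmoothNear (fun q : ℝ × EuclideanSpace ℝ (Fin n) => q.1) (0, 0) :=
    contDiff_fst.smoothNear _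
  have hsnd : SmoothNear (fun q : ℝ × EuclideanSpace ℝ (Fin n) => q.2) (0, 0) :=
    contDiff_snd.smoothNear _
  refine Submodule.subset_span ⟨f, infinitesimalAction f A ξ hA hξ h0,
    -- The affine curve has velocity `(ξ, A)`; it stays in the contact group for small `t` because
    -- units form an open set.
    { H := fun t x => x + t • ξ x
      Φ := fun t x => 1 + t • A x
      mem_contact := ?_
      smooth_H := hsnd.add (hfst.smul (hξ.comp hsnd rfl))
      smooth_Φ := (contDiff_const.smoothNear _).add (hfst.smul (hA.comp hsnd rfl))
      H_zero := by simp
      Φ_zero := Filter.Eventually.of_forall fun x =>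
        (congrArg (1 + ·) (zero_smul ℝ (A x))).trans (add_zero 1) }, rfl, rfl, ?_⟩
  · have hU {m : ℕ} (B : EuclideanSpace ℝ (Fin m) →L[ℝ] EuclideanSpace ℝ (Fin m)) :
        ∀ᶠ t : ℝ in 𝓝 0, IsUnit (1 + t • B) := by
      have hc : ContinuousAt (fun t : ℝ => 1 + t • B) 0 := by fun_prop
      refine hc.eventually (p := fun C => IsUnit C) ?_
      rw [show (fun t : ℝ => 1 + t • B) 0 = 1 from
        (congrArg (1 + ·) (zero_smul ℝ B)).trans (add_zero 1)]
      exact Units.nhds (1 : (EuclideanSpace ℝ (Fin m) →L[ℝ] EuclideanSpace ℝ (Fin m))ˣ)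
    filter_upwards [hU (fderiv ℝ ξ 0), hU (A 0)] with t h1 h2
    refine ⟨(contDiff_id.smoothNear _).add ((contDiff_const.smoothNear _).smul hξ), by simp [h0],
      ?_, (contDiff_const.smoothNear _).add ((contDiff_const.smoothNear _).smul hA), ?_⟩
    · have h3 : HasFDerivAt (fun x => x + t • ξ x) (1 + t • fderiv ℝ ξ 0) 0 :=
        (hasFDerivAt_id _).add
          (hξ.eventually_differentiableAt.self_of_nhds.hasFDerivAt.const_smul t)
      rwa [h3.fderiv]
    · have hc : ContinuousAt (fun x => 1 + t • A x) 0 :=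
        continuousAt_const.add (hA.continuousAt.const_smul t)
      refine hc.eventually (p := fun C => IsUnit C) ?_
      obtain ⟨u, hu⟩ := h2
      change ∀ᶠ C in 𝓝 (1 + t • A 0), IsUnit C
      rw [← hu]
      exact Units.nhds u
  · filter_upwards [f.2.1.eventually_differentiableAt] with x hx
    have h1 : HasDerivAt (fun t : ℝ => x + t • ξ x) (ξ x) 0 := by
      simpa using ((hasDerivAt_id (0 : ℝ)).smul_const (ξ x)).const_add x
    have h2 : HasDerivAt (fun t : ℝ => 1 + t • A x) (A x) 0 := by
      simpa using ((hasDerivAt_id (0 : ℝ)).smul_const (A x)).const_add 1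
    have h3 := h2.clm_apply ((show HasFDerivAt f.1 (fderiv ℝ f.1 x) (x + (0 : ℝ) • ξ x) by
      simpa using hx.hasFDerivAt).comp_hasDerivAt (0 : ℝ) h1)
    simpa [infinitesimalAction] using h3

/-- The infinitesimal action of a contact vector field is well defined on jets. -/
theorem jet_infinitesimalAction_congr {f g : MapGerm n p} (hfg : jet k f = jet k g)
    (A : EuclideanSpace ℝ (Fin n) → (EuclideanSpace ℝ (Fin p) →L[ℝ] EuclideanSpace ℝ (Fin p)))
    (ξ : EuclideanSpace ℝ (Fin n) → EuclideanSpace ℝ (Fin n))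
    (hA : SmoothNear A 0) (hξ : SmoothNear ξ 0) (h0 : ξ 0 = 0) :
    jet k (infinitesimalAction f A ξ hA hξ h0) = jet k (infinitesimalAction g A ξ hA hξ h0) := by
  rw [jet_eq_iff] at hfg ⊢
  have hs := (f - g).2.1
  refine ((hfg.clm_apply hA hs).add (hfg.fderiv_apply hs hξ h0) (hA.clm_apply hs)
    (hs.fderiv.clm_apply hξ)).congr ?_
  filter_upwards [f.2.1.eventually_differentiableAt, g.2.1.eventually_differentiableAt]
    with x h1 h2
  have h3 : fderiv ℝ (f - g).1 x = fderiv ℝ f.1 x - fderiv ℝ g.1 x := fderiv_sub h1 h2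
  rw [h3]
  simp [infinitesimalAction]
  abel

theorem orbitTangent_le {f : MapGerm n p} {T : Submodule ℝ (Jet k n p)}
    (hT : ∀ A ξ, ∀ (hA : SmoothNear A 0) (hξ : SmoothNear ξ 0) (h0 : ξ 0 = 0),
      jet k (infinitesimalAction f A ξ hA hξ h0) ∈ T) :
    orbitTangent k (jet k f) ≤ T := by
  refine Submodule.span_le.2 ?_
  rintro v ⟨f', w, γ, hf, rfl, hw⟩
  obtain ⟨A, ξ, hA, hξ, h0, h⟩ := exists_infinitesimalAction_eventuallyEq hw
  rw [jet_eq_of_eventuallyEq h, jet_infinitesimalAction_congr hf]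
  exact hT A ξ hA hξ h0

end Tangent

/-! ### Comparing codimensions along a restriction. -/

section Pullback

variable {k N P n p : ℕ}

/-- The linear map of germs `v ↦ (y ↦ B y (v (σ y)))`. -/
def twistedPullback (σ : EuclideanSpace ℝ (Fin n) → EuclideanSpace ℝ (Fin N))
    (B : EuclideanSpace ℝ (Fin n) → (EuclideanSpace ℝ (Fin P) →L[ℝ] EuclideanSpace ℝ (Fin p)))
    (hσ : SmoothNear σ 0) (h0 : σ 0 = 0) (hB : SmoothNear B 0) :
    MapGerm N P →ₗ[ℝ] MapGerm n p where
  toFun v := ⟨fun y => B y (v.1 (σ y)), hB.clm_apply (v.2.1.comp hσ h0), by simp [h0, v.2.2]⟩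
  map_add' v w := by ext1; funext y; simp
  map_smul' c v := by ext1; funext y; simp

theorem flatGerms_le_comap_twistedPullback
    (σ : EuclideanSpace ℝ (Fin n) → EuclideanSpace ℝ (Fin N))
    (B : EuclideanSpace ℝ (Fin n) → (EuclideanSpace ℝ (Fin P) →L[ℝ] EuclideanSpace ℝ (Fin p)))
    (hσ : SmoothNear σ 0) (h0 : σ 0 = 0) (hB : SmoothNear B 0) :
    flatGerms k N P ≤ (flatGerms k n p).comap (twistedPullback σ B hσ h0 hB) := fun v hv =>
  (FlatAt.comp (k := k) hv v.2.1 hσ h0).clm_apply hB (v.2.1.comp hσ h0)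

/-- If `f` restricts along `σ` to a copy of `g`, in a way compatible with the differentials, then
the codimension of the orbit of `g` is at most that of `f`. -/
theorem orbitCodim_le_of_restriction {f : MapGerm N P} {g : MapGerm n p}
    {σ : EuclideanSpace ℝ (Fin n) → EuclideanSpace ℝ (Fin N)}
    {B : EuclideanSpace ℝ (Fin n) → (EuclideanSpace ℝ (Fin P) →L[ℝ] EuclideanSpace ℝ (Fin p))}
    {ι : EuclideanSpace ℝ (Fin p) →L[ℝ] EuclideanSpace ℝ (Fin P)}
    {κ : EuclideanSpace ℝ (Fin N) →L[ℝ] EuclideanSpace ℝ (Fin n)}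
    (hσ : SmoothNear σ 0) (h0 : σ 0 = 0) (hB : SmoothNear B 0)
    (hfg : ∀ᶠ y in 𝓝 0, f.1 (σ y) = ι (g.1 y))
    (hd : ∀ᶠ y in 𝓝 0, ∀ η, B y (fderiv ℝ f.1 (σ y) η) = fderiv ℝ g.1 y (κ η))
    (hκ : ∀ᶠ y in 𝓝 0, κ (σ y) = y) (hι : ∀ᶠ y in 𝓝 0, ∀ z, B y (ι z) = z) :
    orbitCodim k (jet k g) ≤ orbitCodim k (jet k f) := by
  let L := twistedPullback σ B hσ h0 hB
  let Lk : Jet k N P →ₗ[ℝ] Jet k n p :=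
    (flatGerms k N P).mapQ _ L (flatGerms_le_comap_twistedPullback σ B hσ h0 hB)
  have hLk (v : MapGerm N P) : Lk (jet k v) = jet k (L v) := rfl
  have hsurj : Function.Surjective Lk := by
    intro z
    obtain ⟨w, rfl⟩ := (flatGerms k n p).mkQ_surjective z
    -- `w ↦ ι ∘ w ∘ κ` is a section, since `κ ∘ σ = id` and `B ∘ ι = id`.
    refine ⟨jet k ⟨fun x => ι (w.1 (κ x)), (ι.smoothNear _).comp
      (w.2.1.comp (κ.smoothNear 0) (map_zero κ)) rfl, by simp [w.2.2]⟩, ?_⟩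
    rw [hLk]
    refine jet_eq_of_eventuallyEq (g := w) ?_
    filter_upwards [hκ, hι] with y h1 h2
    change B y (ι (w.1 (κ (σ y)))) = w.1 y
    rw [h1, h2]
  have hT : orbitTangent k (jet k f) ≤ (orbitTangent k (jet k g)).comap Lk := by
    refine orbitTangent_le fun A ξ hA hξ hξ0 => ?_
    rw [Submodule.mem_comap, hLk]
    -- The pair `(A, ξ)` acting on `f` descends to `(B · A(σ) · ι, κ · ξ(σ))` acting on `g`.
    have hA' : SmoothNear (fun y => (B y).comp ((A (σ y)).comp ι)) 0 :=
      hB.clm_comp ((hA.comp hσ h0).clm_comp (contDiff_const.smoothNear 0))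
    have hξ' : SmoothNear (fun y => κ (ξ (σ y))) 0 :=
      (κ.smoothNear _).comp (hξ.comp hσ h0) rfl
    have hξ0' : κ (ξ (σ 0)) = 0 := by rw [h0, hξ0, map_zero]
    have key := jet_infinitesimalAction_mem (k := k) g _ _ hA' hξ' hξ0'
    convert key using 1
    refine jet_eq_of_eventuallyEq ?_
    filter_upwards [hfg, hd] with y h1 h2
    change B y (A (σ y) (f.1 (σ y)) + fderiv ℝ f.1 (σ y) (ξ (σ y))) =
      B y (A (σ y) (ι (g.1 y))) + fderiv ℝ g.1 y (κ (ξ (σ y)))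
    rw [map_add, h1, h2]
  refine LinearMap.rank_le_of_surjective (Submodule.mapQ _ _ Lk hT) ?_
  intro z
  obtain ⟨w, rfl⟩ := Submodule.mkQ_surjective _ z
  obtain ⟨v, rfl⟩ := hsurj w
  exact ⟨Submodule.mkQ _ v, rfl⟩

end Pullback

/-! ### Linear coordinates adapted to a surjection. -/

section LinearAlgebra

variable {U V W : Type*} [AddCommGroup U] [Module ℝ U] [AddCommGroup V] [Module ℝ V]
  [AddCommGroup W] [Module ℝ W] [FiniteDimensional ℝ U] [FiniteDimensional ℝ V]

/-- A surjection onto `U` extends to an isomorphism with `U × W` when the dimensions fit. -/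
theorem exists_linearEquiv_prod_fst [FiniteDimensional ℝ W] {π : V →ₗ[ℝ] U} (hπ : Function.Surjective π)
    (hd : Module.finrank ℝ V = Module.finrank ℝ U + Module.finrank ℝ W) :
    ∃ e : V ≃ₗ[ℝ] U × W, ∀ v, (e v).1 = π v := by
  obtain ⟨r, hr⟩ := (LinearMap.ker π).subtype.exists_leftInverse_of_injective
    (LinearMap.ker_eq_bot.2 Subtype.val_injective)
  have hk : Module.finrank ℝ (LinearMap.ker π) = Module.finrank ℝ W := by
    have h1 := π.finrank_range_add_finrank_ker
    rw [LinearMap.range_eq_top.2 hπ, finrank_top] at h1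
    omega
  let c := LinearEquiv.ofFinrankEq _ _ hk
  refine ⟨LinearEquiv.ofInjectiveOfFinrankEq (π.prod (c.toLinearMap ∘ₗ r)) ?_
    (by rw [hd, Module.finrank_prod]), fun v => rfl⟩
  rw [← LinearMap.ker_eq_bot, LinearMap.ker_eq_bot']
  intro v hv
  have h1 : π v = 0 := congrArg Prod.fst hv
  have h2 : r v = 0 := c.map_eq_zero_iff.1 (congrArg Prod.snd hv)
  have h3 : r v = ⟨v, h1⟩ := LinearMap.congr_fun hr ⟨v, h1⟩
  exact congrArg Subtype.val (h3.symm.trans h2)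

/-- A linear map of rank at least `dim U` composes with some linear map to a surjection onto
`U`. -/
theorem exists_surjective_comp {D : V →ₗ[ℝ] W}
    (hD : Module.finrank ℝ U ≤ Module.finrank ℝ (LinearMap.range D)) :
    ∃ π : W →ₗ[ℝ] U, Function.Surjective (π ∘ₗ D) := by
  obtain ⟨j, hj⟩ : ∃ j : U →ₗ[ℝ] LinearMap.range D, Function.Injective j :=
    finrank_le_iff_exists_linearMap.1 hD
  obtain ⟨r, hr⟩ := ((LinearMap.range D).subtype ∘ₗ j).exists_leftInverse_of_injective
    (LinearMap.ker_eq_bot.2 (Subtype.val_injective.comp hj))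
  refine ⟨r, fun u => ?_⟩
  obtain ⟨v, hv⟩ := (j u).2
  refine ⟨v, ?_⟩
  rw [LinearMap.comp_apply, hv]
  exact LinearMap.congr_fun hr u

end LinearAlgebra

/-! ### Local inverses of smooth germs. -/

section Inverse

variable {E F : Type*} [NormedAddCommGroup E] [NormedSpace ℝ E] [CompleteSpace E]
  [NormedAddCommGroup F] [NormedSpace ℝ F]

/-- The inverse function theorem for smooth germs. -/
theorem SmoothNear.exists_rightInverse {f : E → F} {a : E} {b : F} (hf : SmoothNear f a)
    (hb : f a = b) {f' : E ≃L[ℝ] F} (hf' : HasFDerivAt f (f' : E →L[ℝ] F) a) :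
    ∃ S : F → E, SmoothNear S b ∧ S b = a ∧ (∀ᶠ y in 𝓝 b, f (S y) = y) ∧
      ∀ᶠ x in 𝓝 a, S (f x) = x := by
  subst hb
  let φ := hf.contDiffAt.toOpenPartialHomeomorph f hf' (by simp)
  have ha : a ∈ φ.source := hf.contDiffAt.mem_toOpenPartialHomeomorph_source hf' (by simp)
  have hb : f a ∈ φ.target := φ.map_source ha
  have hS : φ.symm (f a) = a := φ.left_inv ha
  refine ⟨φ.symm, ?_, hS, ?_, ?_⟩
  · have hu : ∀ᶠ x in 𝓝 a, _root_.fderiv ℝ f x ∈ Set.range ((↑) : (E ≃L[ℝ] F) → E →L[ℝ] F) := by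
      refine hf.fderiv.continuousAt.eventually (p := fun C => C ∈ Set.range _) ?_
      rw [hf'.fderiv]
      exact f'.nhds
    have hc : ContinuousAt φ.symm (f a) := φ.continuousAt_symm hb
    rw [ContinuousAt, hS] at hc
    filter_upwards [φ.open_target.mem_nhds hb, hc.eventually hu, hc.eventually hf,
      hc.eventually hf.eventually_differentiableAt] with y h1 ⟨e, he⟩ h3 h4
    refine φ.contDiffAt_symm (f₀' := e) h1 ?_ h3
    rw [he]
    exact h4.hasFDerivAt
  · filter_upwards [φ.open_target.mem_nhds hb] with y hy using φ.right_inv hy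
  · filter_upwards [φ.open_source.mem_nhds ha] with x hx using φ.left_inv hx

end Inverse

/-! ### Construction of the restricted germ. -/

section Reduction

variable {m n p : ℕ}

/-- Splitting off `m` linear directions: a germ whose differential has rank at least `m` restricts
to a germ with the same kernel rank in `m` fewer source and target dimensions. -/
theorem exists_restriction (f : MapGerm (m + n) (m + p))
    (hr : m ≤ Module.finrank ℝ (LinearMap.range (fderiv ℝ f.1 0).toLinearMap)) :
    ∃ g : MapGerm n p,
      Module.finrank ℝ (LinearMap.ker (fderiv ℝ g.1 0).toLinearMap) =
        Module.finrank ℝ (LinearMap.ker (fderiv ℝ f.1 0).toLinearMap) ∧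
      ∀ k, orbitCodim k (jet k g) ≤ orbitCodim k (jet k f) := by
  let Em := EuclideanSpace ℝ (Fin m)
  let En := EuclideanSpace ℝ (Fin n)
  let Ep := EuclideanSpace ℝ (Fin p)
  obtain ⟨π₀, hπ₀⟩ := exists_surjective_comp (U := Em) (D := (fderiv ℝ f.1 0).toLinearMap)
    (by simpa [Em] using hr)
  have hπ₀' : Function.Surjective π₀ := Function.Surjective.of_comp hπ₀
  obtain ⟨e₀, he₀⟩ := exists_linearEquiv_prod_fst (W := Ep) hπ₀' (by simp [Em, Ep])
  obtain ⟨T₀, hT₀⟩ := exists_linearEquiv_prod_fst (W := En) hπ₀ (by simp [Em, En])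
  let e := e₀.toContinuousLinearEquiv
  let T := T₀.toContinuousLinearEquiv
  let π : EuclideanSpace ℝ (Fin (m + p)) →L[ℝ] Em := (ContinuousLinearMap.fst ℝ Em Ep).comp e.toContinuousLinearMap
  let q : EuclideanSpace ℝ (Fin (m + p)) →L[ℝ] Ep := (ContinuousLinearMap.snd ℝ Em Ep).comp e.toContinuousLinearMap
  let κ : EuclideanSpace ℝ (Fin (m + n)) →L[ℝ] En := (ContinuousLinearMap.snd ℝ Em En).comp T.toContinuousLinearMap
  have hTD (η) : T η = (π (fderiv ℝ f.1 0 η), κ η) :=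
    Prod.ext ((hT₀ η).trans (he₀ _).symm) rfl
  -- Source coordinates in which `π ∘ f` is the projection to `Em`; `G` below is `q ∘ f` in these
  -- coordinates, and `σ` parametrises `π ∘ f = 0`.
  let F : EuclideanSpace ℝ (Fin (m + n)) → Em × En := fun x => (π (f.1 x), κ x)
  have hFd {x} (hx : DifferentiableAt ℝ f.1 x) :
      HasFDerivAt F ((π.comp (fderiv ℝ f.1 x)).prod κ) x :=
    (π.hasFDerivAt.comp x hx.hasFDerivAt).prodMk κ.hasFDerivAt
  have hF : SmoothNear F 0 := by
    filter_upwards [f.2.1] with x hx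
    exact (π.contDiff.contDiffAt.comp x hx).prodMk κ.contDiff.contDiffAt
  have hF' : HasFDerivAt F (T : EuclideanSpace ℝ (Fin (m + n)) →L[ℝ] Em × En) 0 := by
    convert hFd f.2.1.eventually_differentiableAt.self_of_nhds using 1
    ext1 η
    exact hTD η
  have hF0 : F 0 = 0 := by simp [F, f.2.2]
  obtain ⟨S, hS, hS0, hFS, hSF⟩ := hF.exists_rightInverse hF0 hF'
  let G : Em × En → Ep := fun z => q (f.1 (S z))
  have hG : SmoothNear G 0 := (q.smoothNear _).comp (f.2.1.comp hS hS0) rfl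
  have hGF : ∀ᶠ x in 𝓝 0, G (F x) = q (f.1 x) := by
    filter_upwards [hSF] with x hx
    simp only [G, hx]
  let j : En →L[ℝ] Em × En := ContinuousLinearMap.inr ℝ Em En
  have hj : SmoothNear (fun y : En => j y) 0 := j.smoothNear 0
  have hj0 : j 0 = 0 := map_zero j
  let σ : En → EuclideanSpace ℝ (Fin (m + n)) := fun y => S (j y)
  have hσ : SmoothNear σ 0 := hS.comp hj hj0
  have hσ0 : σ 0 = 0 := by simp only [σ, hj0, hS0]
  have hjt : Filter.Tendsto j (𝓝 0) (𝓝 0) := by simpa [hj0] using hj.continuousAt.tendsto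
  have hσt : Filter.Tendsto σ (𝓝 0) (𝓝 0) := by simpa [hσ0] using hσ.continuousAt.tendsto
  let g : MapGerm n p := ⟨fun y => G (j y), hG.comp hj hj0, by
    simp only [hj0, G, hS0, f.2.2, map_zero]⟩
  -- The correction removes from `q · df` the derivative of `G` along `Em`, leaving the `En` part,
  -- which is `dg · κ`.
  let B : En → (EuclideanSpace ℝ (Fin (m + p)) →L[ℝ] Ep) := fun y =>
    q - (fderiv ℝ G (j y)).comp ((ContinuousLinearMap.inl ℝ Em En).comp π)
  have hB : SmoothNear B 0 := (contDiff_const.smoothNear 0).sub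
    ((hG.fderiv.comp hj hj0).clm_comp (contDiff_const.smoothNear 0))
  let ι : Ep →L[ℝ] EuclideanSpace ℝ (Fin (m + p)) :=
    (e.symm : Em × Ep →L[ℝ] _).comp (ContinuousLinearMap.inr ℝ Em Ep)
  have hπι (z) : π (ι z) = 0 := by simp [π, ι]
  have hqι (z) : q (ι z) = z := by simp [q, ι]
  have hFσ : ∀ᶠ y in 𝓝 0, F (σ y) = j y := hjt.eventually hFS
  have hd : ∀ᶠ y in 𝓝 0, ∀ η, B y (fderiv ℝ f.1 (σ y) η) = fderiv ℝ g.1 y (κ η) := by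
    filter_upwards [hFσ, hσt.eventually hGF.eventually_nhds,
      hσt.eventually f.2.1.eventually_differentiableAt,
      hjt.eventually hG.eventually_differentiableAt] with y h1 h2 h3 h4 η
    have h5 : HasFDerivAt (fun x => q (f.1 x)) (q.comp (fderiv ℝ f.1 (σ y))) (σ y) :=
      q.hasFDerivAt.comp (σ y) h3.hasFDerivAt
    have h6 : HasFDerivAt (fun x => G (F x))
        ((fderiv ℝ G (j y)).comp ((π.comp (fderiv ℝ f.1 (σ y))).prod κ)) (σ y) :=
      HasFDerivAt.comp (g := G) (σ y) (by rw [h1]; exact h4.hasFDerivAt) (hFd h3)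
    -- The chain rule for `G ∘ F = q ∘ f`.
    have h7 : fderiv ℝ G (j y) (π (fderiv ℝ f.1 (σ y) η), κ η) = q (fderiv ℝ f.1 (σ y) η) :=
      congrArg (fun C => C η) (h6.unique (h5.congr_of_eventuallyEq h2))
    have h8 : HasFDerivAt g.1 ((fderiv ℝ G (j y)).comp j) y :=
      h4.hasFDerivAt.comp y j.hasFDerivAt
    rw [h8.fderiv]
    change q _ - fderiv ℝ G (j y) (π _, 0) = fderiv ℝ G (j y) (0, κ η)
    rw [← h7, ← map_sub]
    simp
  refine ⟨g, ?_, fun k => orbitCodim_le_of_restriction (ι := ι) (κ := κ) hσ hσ0 hB ?_ hd ?_ ?_⟩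
  · have hd0 := hd.self_of_nhds
    rw [hσ0] at hd0
    have hmem (η : LinearMap.ker (fderiv ℝ f.1 0).toLinearMap) :
        κ η ∈ LinearMap.ker (fderiv ℝ g.1 0).toLinearMap := by
      have h1 : fderiv ℝ f.1 0 η = 0 := η.2
      change fderiv ℝ g.1 0 (κ η) = 0
      rw [← hd0, h1, map_zero]
    refine (LinearEquiv.ofBijective ((κ.toLinearMap ∘ₗ Submodule.subtype _).codRestrict _ hmem)
      ⟨?_, ?_⟩).finrank_eq.symm
    · rw [← LinearMap.ker_eq_bot, LinearMap.ker_eq_bot']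
      intro η hη
      have h1 : fderiv ℝ f.1 0 η = 0 := η.2
      have h2 : κ η = 0 := congrArg Subtype.val hη
      have h3 : T η = 0 := by rw [hTD, h1, h2, map_zero]; rfl
      exact Subtype.ext (T.map_eq_zero_iff.1 h3)
    · rintro ⟨z, hz⟩
      have h1 := hTD (T.symm (0, z))
      rw [T.apply_symm_apply] at h1
      have h2 : π (fderiv ℝ f.1 0 (T.symm (0, z))) = 0 := (congrArg Prod.fst h1).symm
      have h3 : κ (T.symm (0, z)) = z := (congrArg Prod.snd h1).symm
      -- On this vector `π · df` vanishes, so `B` acts on its image as `q`; hence `dg z = 0` forces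
      -- `q · df = 0` as well.
      have h4 := hd0 (T.symm (0, z))
      rw [h3, show fderiv ℝ g.1 0 z = 0 from hz] at h4
      change q _ - fderiv ℝ G (j 0) (π _, 0) = 0 at h4
      rw [h2, ← Prod.zero_eq_mk, map_zero, sub_zero] at h4
      exact ⟨⟨T.symm (0, z), e.map_eq_zero_iff.1 (Prod.ext h2 h4)⟩, Subtype.ext h3⟩
  · filter_upwards [hFσ] with y hy
    apply e.injective
    change e _ = e (e.symm (0, q (f.1 (σ y))))
    rw [e.apply_symm_apply]
    have h1 : π (f.1 (σ y)) = 0 := congrArg Prod.fst hy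
    exact Prod.ext h1 rfl
  · filter_upwards [hFσ] with y hy using congrArg Prod.snd hy
  · refine Filter.Eventually.of_forall fun y z => ?_
    change q (ι z) - fderiv ℝ G (j y) (π (ι z), 0) = z
    rw [hπι, hqι, ← Prod.zero_eq_mk, map_zero, sub_zero]

end Reduction

end KJet

end

theorem proposition4p3 (n p i k l : ℕ) (hi : i ≤ n) (hk : p + l + 1 ≤ k)
    (h : KJet.SigmaSet i k n p ⊆ KJet.WSet (l + 1) k n p) (m : ℕ) (hm : 1 ≤ m) :
    KJet.SigmaSet i k (m + n) (m + p) ⊆ KJet.WSet (l + 1) k (m + n) (m + p) := by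
  rintro _ ⟨f, rfl, hf⟩
  have hr := (fderiv ℝ f.1 0).toLinearMap.finrank_range_add_finrank_ker
  rw [hf, finrank_euclideanSpace_fin] at hr
  obtain ⟨g, hg, hle⟩ := KJet.exists_restriction f (by omega)
  have hg' : ((l + 1 : ℕ) : Cardinal) ≤ KJet.orbitCodim k (KJet.jet k g) :=
    h ⟨g, rfl, hg.trans hf⟩
  exact hg'.trans (hle k)
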